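/- Let $(\mathcal A;\mathcal E)$ be a Frobenius category, that is, an exact category in the sense of Quillen with enough projective and enough injective objects, whose projective objects coincide with its injective objects. Let $\omega$ be the full subcategory of projective objects, and let $\mathcal A/\omega$ be the stable category: it has the same objects as $\mathcal A$, and its morphisms are the residue classes $\underline f$ of morphisms $f$ of $\mathcal A$ modulo the morphisms factoring through an object of $\omega$. Choose for each object $X$ a conflation $X\rightarrowtail I(X)\twoheadrightarrow T(X)$ with $I(X)\in\omega$, and let $[1]:\mathcal A/\omega\to\mathcal A/\omega$ be the resulting shift functor: $X[1]=T(X)$, and for $f:X\to Y$ one has $\underline f[1]=\underline t$, where $t:T(X)\to T(Y)$ is any morphism which is part of a morphism of conflations $(f,u,t)$. For $a:A_0\to A_1$ and $b:B_0\to B_1$ in $\mathcal A$ let $\mathrm{Ext}(a,b):\mathrm{Ext}(A_1,B_0)\to\mathrm{Ext}(A_0,B_1)$ be the induced map on groups of equivalence classes of conflations (pullback along $a$ and pushout along $b$). For a class $\mathcal M$ of morphisms of $\mathcal A$ put $$\mathcal M^{\perp}=\{b\mid \mathrm{Ext}(m,b)=0\ \text{for all}\ m\in\mathcal M\},\qquad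 {}^{\perp}\mathcal M=\{a\mid \mathrm{Ext}(a,m)=0\ \text{for all}\ m\in\mathcal M\},$$ and $\mathcal M/\omega=\{\underline m\mid m\in\mathcal M\}$. For morphisms $f:X\to A$ and $g:B\to Y$ of $\mathcal A/\omega$ write $f\perp g$ if $g[1]\,\varphi\,f=0$ for every morphism $\varphi:A\to B[1]$ in $\mathcal A/\omega$. For a class $\mathcal N$ of morphisms of $\mathcal A/\omega$ put $\mathcal N^{\perp}=\{g\mid n\perp g\ \text{for all}\ n\in\mathcal N\}$ and ${}^{\perp}\mathcal N=\{f\mid f\perp n\ \text{for all}\ n\in\mathcal N\}$. Let $\mathcal S$ be a class of morphisms of $\mathcal A$ such that $1_X\in\mathcal S$ for every $X\in\omega$. Then $$(\mathcal S/\omega)^{\perp}=\mathcal S^{\perp}/\omega\qquad\text{and}\qquad {}^{\perp}(\mathcal S/\omega)=({}^{\perp}\mathcal S)/\omega .$$ -/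

import Mathlib

open CategoryTheory CategoryTheory.Limits

universe v u v' u'

noncomputable section

namespace IdealApprox

/-! ### Exact categories -/

section Exact

variable {A : Type u} [Category.{v} A] [Preadditive A]

/-- `i` is an inflation (admissible monomorphism) for the class `conf` of short complexes:
it is the first morphism of a member of `conf`. -/
def IsInflation (conf : ObjectProperty (ShortComplex A)) {X Y : A} (i : X ⟶ Y) : Prop :=
  ∃ (Z : A) (p : Y ⟶ Z) (w : i ≫ p = 0), conf (ShortComplex.mk i p w)

/-- `p` is a deflation (admissible epimorphism) for the class `conf` of short complexes:
it is the second morphism of a member of `conf`. -/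
def IsDeflation (conf : ObjectProperty (ShortComplex A)) {Y Z : A} (p : Y ⟶ Z) : Prop :=
  ∃ (X : A) (i : X ⟶ Y) (w : i ≫ p = 0), conf (ShortComplex.mk i p w)

variable (A) in
/-- A Quillen exact structure on the additive category `A`: a class of kernel-cokernel pairs,
the conflations, closed under isomorphisms, such that identities are inflations and deflations,
inflations (resp. deflations) compose, pushouts of inflations (resp. pullbacks of deflations)
along arbitrary morphisms exist and are again inflations (resp. deflations). -/
structure ExactStructure where
  /-- The class of conflations. -/
  conf : ObjectProperty (ShortComplex A)
  iso_closed : ∀ ⦃S T : ShortComplex A⦄, (S ≅ T) → conf S → conf T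
  kernel : ∀ ⦃S : ShortComplex A⦄, conf S → Nonempty (IsLimit (KernelFork.ofι S.f S.zero))
  cokernel : ∀ ⦃S : ShortComplex A⦄, conf S →
    Nonempty (IsColimit (CokernelCofork.ofπ S.g S.zero))
  inflation_id : ∀ X : A, IsInflation conf (𝟙 X)
  deflation_id : ∀ X : A, IsDeflation conf (𝟙 X)
  inflation_comp : ∀ ⦃X Y Z : A⦄ (i : X ⟶ Y) (j : Y ⟶ Z),
    IsInflation conf i → IsInflation conf j → IsInflation conf (i ≫ j)
  deflation_comp : ∀ ⦃X Y Z : A⦄ (p : X ⟶ Y) (q : Y ⟶ Z),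
    IsDeflation conf p → IsDeflation conf q → IsDeflation conf (p ≫ q)
  pushout_inflation : ∀ ⦃X Y X' : A⦄ (i : X ⟶ Y) (f : X ⟶ X'), IsInflation conf i →
    ∃ (Y' : A) (f' : Y ⟶ Y') (i' : X' ⟶ Y'), IsPushout i f f' i' ∧ IsInflation conf i'
  pullback_deflation : ∀ ⦃Y Z Z' : A⦄ (p : Y ⟶ Z) (f : Z' ⟶ Z), IsDeflation conf p →
    ∃ (Y' : A) (f' : Y' ⟶ Y) (p' : Y' ⟶ Z'), IsPullback f' p' p f ∧ IsDeflation conf p'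

namespace ExactStructure

variable (E : ExactStructure A)

/-- `P` is projective if every deflation ending at `P` splits. -/
def Projective (P : A) : Prop :=
  ∀ ⦃X : A⦄ (p : X ⟶ P), IsDeflation E.conf p → IsSplitEpi p

/-- `I` is injective if every inflation starting at `I` splits. -/
def Injective (I : A) : Prop :=
  ∀ ⦃X : A⦄ (i : I ⟶ X), IsInflation E.conf i → IsSplitMono i

/-- The exact category is Frobenius: it has enough projectives and enough injectives,
and the projective objects coincide with the injective objects. -/
structure IsFrobenius : Prop where
  enough_projectives : ∀ X : A, ∃ (P : A) (p : P ⟶ X), E.Projective P ∧ IsDeflation E.conf p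
  enough_injectives : ∀ X : A, ∃ (I : A) (i : X ⟶ I), E.Injective I ∧ IsInflation E.conf i
  projective_iff_injective : ∀ X : A, E.Projective X ↔ E.Injective X

variable {E}

theorem mono_of_conf {S : ShortComplex A} (h : E.conf S) : Mono S.f := by
  obtain ⟨hk⟩ := E.kernel h
  exact ⟨fun a b hab => Fork.IsLimit.hom_ext hk hab⟩

theorem epi_of_conf {S : ShortComplex A} (h : E.conf S) : Epi S.g := by
  obtain ⟨hk⟩ := E.cokernel h
  exact ⟨fun a b hab => Cofork.IsColimit.hom_ext hk hab⟩

theorem exists_desc_of_conf {S : ShortComplex A} (h : E.conf S) {W : A} (k : S.X₂ ⟶ W)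
    (hk : S.f ≫ k = 0) : ∃ l : S.X₃ ⟶ W, S.g ≫ l = k := by
  obtain ⟨hc⟩ := E.cokernel h
  exact ⟨_, (CokernelCofork.IsColimit.desc' hc k hk).2⟩

theorem exists_lift_of_conf {S : ShortComplex A} (h : E.conf S) {W : A} (k : W ⟶ S.X₂)
    (hk : k ≫ S.g = 0) : ∃ l : W ⟶ S.X₁, l ≫ S.f = k := by
  obtain ⟨hc⟩ := E.kernel h
  exact ⟨_, (KernelFork.IsLimit.lift' hc k hk).2⟩

/-- An inflation together with any cokernel of it is a conflation. -/
theorem conf_of_inflation {X Y Z : A} {i : X ⟶ Y} (hi : IsInflation E.conf i) (p : Y ⟶ Z)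
    (w : i ≫ p = 0) [Epi p]
    (hp : ∀ {W : A} (k : Y ⟶ W), i ≫ k = 0 → ∃ l : Z ⟶ W, p ≫ l = k) :
    E.conf (ShortComplex.mk i p w) := by
  obtain ⟨Z', q, w', hq⟩ := hi
  have : Epi q := epi_of_conf hq
  obtain ⟨a, ha⟩ := exists_desc_of_conf hq p w
  obtain ⟨b, hb⟩ := hp q w'
  dsimp at a ha
  have h1 : a ≫ b = 𝟙 _ := by rw [← cancel_epi q]; simp [reassoc_of% ha, hb]
  have h2 : b ≫ a = 𝟙 _ := by rw [← cancel_epi p]; simp [reassoc_of% hb, ha]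
  exact E.iso_closed (ShortComplex.isoMk (S₁ := ShortComplex.mk i q w')
    (S₂ := ShortComplex.mk i p w) (Iso.refl _) (Iso.refl _) ⟨a, b, h1, h2⟩
    (by simp) (by simp [ha])) hq

/-- A deflation together with any kernel of it is a conflation. -/
theorem conf_of_deflation {X Y Z : A} {p : Y ⟶ Z} (hp : IsDeflation E.conf p) (i : X ⟶ Y)
    (w : i ≫ p = 0) [Mono i]
    (hi : ∀ {W : A} (k : W ⟶ Y), k ≫ p = 0 → ∃ l : W ⟶ X, l ≫ i = k) :
    E.conf (ShortComplex.mk i p w) := by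
  obtain ⟨X', j, w', hj⟩ := hp
  have : Mono j := mono_of_conf hj
  obtain ⟨a, ha⟩ := exists_lift_of_conf hj i w
  obtain ⟨b, hb⟩ := hi j w'
  dsimp at a ha
  have h1 : b ≫ a = 𝟙 _ := by rw [← cancel_mono j]; simp [ha, hb]
  have h2 : a ≫ b = 𝟙 _ := by rw [← cancel_mono i]; simp [hb, ha]
  exact E.iso_closed (ShortComplex.isoMk (S₁ := ShortComplex.mk j p w')
    (S₂ := ShortComplex.mk i p w) ⟨b, a, h1, h2⟩ (Iso.refl _) (Iso.refl _)
    (by simp [hb]) (by simp)) hj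

/-! ### The bifunctor `Ext` -/

variable (E) in
/-- A conflation `Y ↣ M ↠ X` with prescribed ends. -/
structure Extension (X Y : A) where
  /-- The middle term. -/
  M : A
  /-- The inflation. -/
  f : Y ⟶ M
  /-- The deflation. -/
  g : M ⟶ X
  w : f ≫ g = 0
  conf : E.conf (ShortComplex.mk f g w)

/-- Equivalence of extensions: an isomorphism of the middle terms which is compatible with
the identities of the end terms. -/
instance extensionSetoid (X Y : A) : Setoid (E.Extension X Y) where
  r ξ η := ∃ e : ξ.M ≅ η.M, ξ.f ≫ e.hom = η.f ∧ e.hom ≫ η.g = ξ.g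
  iseqv :=
    { refl := fun ξ => ⟨Iso.refl _, by simp, by simp⟩
      symm := by
        rintro ξ η ⟨e, h1, h2⟩
        exact ⟨e.symm, by simp [← h1], by simp [← h2]⟩
      trans := by
        rintro ξ η ζ ⟨e, h1, h2⟩ ⟨e', h1', h2'⟩
        exact ⟨e ≪≫ e', by simp [reassoc_of% h1, h1'], by simp [h2, h2']⟩ }

variable (E) in
/-- `Ext(X, Y)`: the equivalence classes of conflations `Y ↣ M ↠ X`. -/
def Ext (X Y : A) : Type (max u v) := _root_.Quotient (extensionSetoid (E := E) X Y)

theorem exists_pushforward {X Y Y' : A} (ξ : E.Extension X Y) (b : Y ⟶ Y') :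
    ∃ (η : E.Extension X Y') (c : ξ.M ⟶ η.M), IsPushout ξ.f b c η.f ∧ c ≫ η.g = ξ.g := by
  obtain ⟨P, c, i, hP, hi⟩ := E.pushout_inflation ξ.f b ⟨_, _, _, ξ.conf⟩
  have hg : Epi ξ.g := epi_of_conf ξ.conf
  let q : P ⟶ X := hP.desc ξ.g 0 (by simp [ξ.w])
  have hq1 : c ≫ q = ξ.g := hP.inl_desc _ _ _
  have hq2 : i ≫ q = 0 := hP.inr_desc _ _ _
  have : Epi (c ≫ q) := hq1 ▸ hg
  have : Epi q := epi_of_epi c q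
  refine ⟨⟨P, i, q, hq2, conf_of_inflation hi q hq2 ?_⟩, c, hP, hq1⟩
  intro W k hk
  obtain ⟨l, hl⟩ := exists_desc_of_conf ξ.conf (c ≫ k)
    (by dsimp; rw [hP.w_assoc, hk, comp_zero])
  dsimp at l hl
  exact ⟨l, hP.hom_ext (by rw [reassoc_of% hq1, hl]) (by rw [reassoc_of% hq2, zero_comp, hk])⟩

theorem exists_pullback {X X' Y : A} (ξ : E.Extension X Y) (a : X' ⟶ X) :
    ∃ (η : E.Extension X' Y) (c : η.M ⟶ ξ.M), IsPullback c η.g ξ.g a ∧ η.f ≫ c = ξ.f := by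
  obtain ⟨P, c, p, hP, hp⟩ := E.pullback_deflation ξ.g a ⟨_, _, _, ξ.conf⟩
  have hf : Mono ξ.f := mono_of_conf ξ.conf
  let j : Y ⟶ P := hP.lift ξ.f 0 (by simp [ξ.w])
  have hj1 : j ≫ c = ξ.f := hP.lift_fst _ _ _
  have hj2 : j ≫ p = 0 := hP.lift_snd _ _ _
  have : Mono (j ≫ c) := hj1 ▸ hf
  have : Mono j := mono_of_mono j c
  refine ⟨⟨P, j, p, hj2, conf_of_deflation hp j hj2 ?_⟩, c, hP, hj1⟩
  intro W k hk
  obtain ⟨l, hl⟩ := exists_lift_of_conf ξ.conf (k ≫ c)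
    (by dsimp; rw [Category.assoc, hP.w, reassoc_of% hk, zero_comp])
  dsimp at l hl
  exact ⟨l, hP.hom_ext (by rw [Category.assoc, hj1, hl])
    (by rw [Category.assoc, hj2, comp_zero, hk])⟩

/-- The pushout of an extension `Y ↣ M ↠ X` along `b : Y ⟶ Y'`. -/
def Extension.pushforward {X Y Y' : A} (ξ : E.Extension X Y) (b : Y ⟶ Y') : E.Extension X Y' :=
  (exists_pushforward ξ b).choose

/-- The pullback of an extension `Y ↣ M ↠ X` along `a : X' ⟶ X`. -/
def Extension.pullback {X X' Y : A} (ξ : E.Extension X Y) (a : X' ⟶ X) : E.Extension X' Y :=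
  (exists_pullback ξ a).choose

theorem Extension.pushforward_spec {X Y Y' : A} (ξ : E.Extension X Y) (b : Y ⟶ Y') :
    ∃ c : ξ.M ⟶ (ξ.pushforward b).M,
      IsPushout ξ.f b c (ξ.pushforward b).f ∧ c ≫ (ξ.pushforward b).g = ξ.g :=
  (exists_pushforward ξ b).choose_spec

theorem Extension.pullback_spec {X X' Y : A} (ξ : E.Extension X Y) (a : X' ⟶ X) :
    ∃ c : (ξ.pullback a).M ⟶ ξ.M,
      IsPullback c (ξ.pullback a).g ξ.g a ∧ (ξ.pullback a).f ≫ c = ξ.f :=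
  (exists_pullback ξ a).choose_spec

theorem Extension.pushforward_congr {X Y Y' : A} {ξ η : E.Extension X Y} (h : ξ ≈ η)
    (b : Y ⟶ Y') : ξ.pushforward b ≈ η.pushforward b := by
  obtain ⟨e, h1, h2⟩ := h
  obtain ⟨c, hc, hc'⟩ := ξ.pushforward_spec b
  obtain ⟨d, hd, hd'⟩ := η.pushforward_spec b
  have hd2 : IsPushout ξ.f b (e.hom ≫ d) (η.pushforward b).f :=
    hd.of_iso (Iso.refl _) e.symm (Iso.refl _) (Iso.refl _)
      (by simp [← h1]) (by simp) (by simp) (by simp)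
  refine ⟨hc.isoIsPushout _ _ hd2, hc.inr_isoIsPushout_hom _ _ hd2, ?_⟩
  refine hc.hom_ext ?_ ?_
  · rw [← Category.assoc, hc.inl_isoIsPushout_hom, Category.assoc, hd', h2, hc']
  · rw [← Category.assoc, hc.inr_isoIsPushout_hom, Extension.w, Extension.w]

theorem Extension.pullback_congr {X X' Y : A} {ξ η : E.Extension X Y} (h : ξ ≈ η)
    (a : X' ⟶ X) : ξ.pullback a ≈ η.pullback a := by
  obtain ⟨e, h1, h2⟩ := h
  obtain ⟨c, hc, hc'⟩ := ξ.pullback_spec a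
  obtain ⟨d, hd, hd'⟩ := η.pullback_spec a
  have hc2 : IsPullback (c ≫ e.hom) (ξ.pullback a).g η.g a :=
    hc.of_iso (Iso.refl _) e (Iso.refl _) (Iso.refl _)
      (by simp) (by simp) (by simp [h2]) (by simp)
  refine ⟨hc2.isoIsPullback _ _ hd, ?_, hc2.isoIsPullback_hom_snd _ _ hd⟩
  refine hd.hom_ext ?_ ?_
  · rw [Category.assoc, hc2.isoIsPullback_hom_fst, ← Category.assoc, hc', h1, hd']
  · rw [Category.assoc, hc2.isoIsPullback_hom_snd, Extension.w, Extension.w]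

/-- `Ext(a, b) : Ext(A₁, B₀) → Ext(A₀, B₁)` for `a : A₀ ⟶ A₁` and `b : B₀ ⟶ B₁`: pull back
along `a`, then push out along `b`. -/
def Ext.map {A₀ A₁ B₀ B₁ : A} (a : A₀ ⟶ A₁) (b : B₀ ⟶ B₁) (x : E.Ext A₁ B₀) : E.Ext A₀ B₁ :=
  _root_.Quotient.map (fun ξ => (ξ.pullback a).pushforward b)
    (fun _ _ h => Extension.pushforward_congr (Extension.pullback_congr h a) b) x

/-- In a Frobenius category, morphisms to objects of `ω` extend along inflations. -/
theorem exists_extension (hE : E.IsFrobenius) {X Y J : A} {i : X ⟶ Y}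
    (hi : IsInflation E.conf i) (hJ : E.Projective J) (f : X ⟶ J) : ∃ g : Y ⟶ J, i ≫ g = f := by
  obtain ⟨P, c, j, hP, hj⟩ := E.pushout_inflation i f hi
  have := (hE.projective_iff_injective J).1 hJ j hj
  exact ⟨c ≫ retraction j, by rw [hP.w_assoc]; simp⟩

section Biproducts

open scoped ZeroObject

variable [HasZeroObject A] [HasBinaryBiproducts A]

variable (E) in
theorem conf_biprod (X Y : A) :
    E.conf (ShortComplex.mk (biprod.inl : Y ⟶ Y ⊞ X) biprod.snd (by simp)) := by
  obtain ⟨K, k, w, hk⟩ := E.deflation_id X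
  have hk0 : k = 0 := by simpa using w
  have : Mono k := mono_of_conf hk
  have hK : 𝟙 K = 0 := by rw [← cancel_mono k]; simp [hk0]
  have hzero : ∀ {W : A} (f g : K ⟶ W), f = g := fun f g => by
    rw [← Category.id_comp f, ← Category.id_comp g, hK, zero_comp, zero_comp]
  obtain ⟨P, f', i', hP, hi'⟩ := E.pushout_inflation k (0 : K ⟶ Y) ⟨_, _, _, hk⟩
  have hB : IsPushout k (0 : K ⟶ Y) biprod.inr (biprod.inl : Y ⟶ Y ⊞ X) :=
    { w := hzero _ _
      isColimit' := ⟨PushoutCocone.IsColimit.mk _ (fun s => biprod.desc s.inr s.inl)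
        (fun s => by simp) (fun s => by simp)
        (fun s m h1 h2 => by ext <;> simp [h1, h2])⟩ }
  have hinl : IsInflation E.conf (biprod.inl : Y ⟶ Y ⊞ X) := by
    obtain ⟨Z, p, w', hp⟩ := hi'
    let e := hP.isoIsPushout _ _ hB
    have he : i' ≫ e.hom = biprod.inl := hP.inr_isoIsPushout_hom _ _ hB
    refine ⟨Z, e.inv ≫ p, by simp [← he, w'], E.iso_closed (ShortComplex.isoMk
      (S₁ := ShortComplex.mk i' p w')
      (S₂ := ShortComplex.mk biprod.inl (e.inv ≫ p) (by simp [← he, w']))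
      (Iso.refl _) e (Iso.refl _) (by simp [he]) (by simp)) hp⟩
  exact conf_of_inflation hinl _ _
    (fun k hk => ⟨biprod.inr ≫ k, by ext <;> simp [hk]⟩)

variable (E) in
/-- The split extension `Y ↣ Y ⊞ X ↠ X`. -/
def Extension.split (X Y : A) : E.Extension X Y :=
  ⟨Y ⊞ X, biprod.inl, biprod.snd, by simp, conf_biprod E X Y⟩

/-- The zero element of `Ext(X, Y)` (the neutral element of the Baer sum) is the class of the
split extension. -/
instance (X Y : A) : Zero (E.Ext X Y) :=
  ⟨_root_.Quotient.mk _ (Extension.split E X Y)⟩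

variable (E) in
/-- `a` and `b` are `Ext`-orthogonal: the map `Ext(a, b) : Ext(A₁, B₀) → Ext(A₀, B₁)` is `0`. -/
def ExtOrthogonal {A₀ A₁ B₀ B₁ : A} (a : A₀ ⟶ A₁) (b : B₀ ⟶ B₁) : Prop :=
  ∀ x : E.Ext A₁ B₀, Ext.map a b x = 0

variable (E) in
/-- `M^⊥ = {b | Ext(m, b) = 0 for all m ∈ M}`. -/
def rightPerp (M : MorphismProperty A) : MorphismProperty A :=
  fun _ _ b => ∀ ⦃A₀ A₁ : A⦄ (m : A₀ ⟶ A₁), M m → E.ExtOrthogonal m b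

variable (E) in
/-- `^⊥M = {a | Ext(a, m) = 0 for all m ∈ M}`. -/
def leftPerp (M : MorphismProperty A) : MorphismProperty A :=
  fun _ _ a => ∀ ⦃B₀ B₁ : A⦄ (m : B₀ ⟶ B₁), M m → E.ExtOrthogonal a m

/-! ### The stable category -/

theorem projective_biprod {P Q : A} (hP : E.Projective P) (hQ : E.Projective Q) :
    E.Projective (P ⊞ Q) := by
  intro X p hp
  obtain ⟨_, u, p₁, h₁, hp₁⟩ := E.pullback_deflation p (biprod.inl : P ⟶ P ⊞ Q) hp
  obtain ⟨_, u', p₂, h₂, hp₂⟩ := E.pullback_deflation p (biprod.inr : Q ⟶ P ⊞ Q) hp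
  have := hP p₁ hp₁
  have := hQ p₂ hp₂
  refine ⟨⟨⟨biprod.desc (section_ p₁ ≫ u) (section_ p₂ ≫ u'), ?_⟩⟩⟩
  ext <;> simp [h₁.w, h₂.w]

theorem projective_zero : E.Projective (0 : A) := by
  intro X p _
  exact ⟨⟨⟨0, by ext⟩⟩⟩

variable (E) in
/-- `f` and `g` are stably equal: `f - g` factors through an object of `ω`, the class of
projective objects. -/
def stableRel : HomRel A := fun X Y f g =>
  ∃ (P : A) (_ : E.Projective P) (s : X ⟶ P) (t : P ⟶ Y), s ≫ t = f - g

theorem stableRel_add {X Y : A} (f₁ f₂ g₁ g₂ : X ⟶ Y) (h : E.stableRel f₁ f₂)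
    (h' : E.stableRel g₁ g₂) : E.stableRel (f₁ + g₁) (f₂ + g₂) := by
  obtain ⟨P, hP, s, t, w⟩ := h
  obtain ⟨P', hP', s', t', w'⟩ := h'
  exact ⟨P ⊞ P', projective_biprod hP hP', biprod.lift s s', biprod.desc t t', by
    simp only [biprod.lift_desc, w, w']; abel⟩

instance : Congruence E.stableRel where
  equivalence :=
    { refl := fun f => by
        exact ⟨0, projective_zero, 0, 0, by simp⟩
      symm := by
        rintro f g ⟨P, hP, s, t, w⟩
        exact ⟨P, hP, -s, t, by simp [w]⟩
      trans := by
        rintro f g h ⟨P, hP, s, t, w⟩ ⟨P', hP', s', t', w'⟩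
        exact ⟨P ⊞ P', projective_biprod hP hP', biprod.lift s s', biprod.desc t t', by
          simp only [biprod.lift_desc, w, w']; abel⟩ }
  comp_left := by
    rintro X Y Z f g g' ⟨P, hP, s, t, w⟩
    exact ⟨P, hP, f ≫ s, t, by simp [w]⟩
  comp_right := by
    rintro X Y Z f f' g ⟨P, hP, s, t, w⟩
    exact ⟨P, hP, s, t ≫ g, by simp [reassoc_of% w]⟩

variable (E) in
/-- The stable category `A/ω`: same objects as `A`, morphisms of `A` modulo those factoring
through an object of `ω`. -/
abbrev StableCategory : Type u := CategoryTheory.Quotient E.stableRel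

instance : Preadditive E.StableCategory :=
  CategoryTheory.Quotient.preadditive E.stableRel fun _ _ => stableRel_add

variable (E) in
/-- The projection functor `A ⥤ A/ω`. -/
abbrev toStable : A ⥤ E.StableCategory := CategoryTheory.Quotient.functor E.stableRel

variable (E) in
/-- `M/ω`: the class of the residue classes in `A/ω` of the morphisms in `M`. -/
def modω (M : MorphismProperty A) : MorphismProperty E.StableCategory :=
  M.strictMap E.toStable

variable (E) in
/-- A choice, for every object `X`, of a conflation `X ↣ I X ↠ T X` with `I X` in `ω`. -/
structure SuspensionChoice where
  /-- The middle term, an object of `ω`. -/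
  I : A → A
  /-- The suspension of an object. -/
  T : A → A
  /-- The inflation `X ↣ I X`. -/
  ι : ∀ X, X ⟶ I X
  /-- The deflation `I X ↠ T X`. -/
  π : ∀ X, I X ⟶ T X
  w : ∀ X, ι X ≫ π X = 0
  conf : ∀ X, E.conf (ShortComplex.mk (ι X) (π X) (w X))
  mem_ω : ∀ X, E.Projective (I X)

theorem nonempty_suspensionChoice (hE : E.IsFrobenius) : Nonempty E.SuspensionChoice := by
  choose I ι hI hι using hE.enough_injectives
  choose T π w h using hι
  exact ⟨⟨I, T, ι, π, w, h, fun X => (hE.projective_iff_injective _).2 (hI X)⟩⟩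

variable (D : E.SuspensionChoice)

theorem SuspensionChoice.exists_map (hE : E.IsFrobenius) {X Y : A} (f : X ⟶ Y) :
    ∃ (u : D.I X ⟶ D.I Y) (t : D.T X ⟶ D.T Y),
      D.ι X ≫ u = f ≫ D.ι Y ∧ D.π X ≫ t = u ≫ D.π Y := by
  obtain ⟨u, hu⟩ := exists_extension hE ⟨_, _, _, D.conf X⟩ (D.mem_ω Y) (f ≫ D.ι Y)
  obtain ⟨t, ht⟩ := exists_desc_of_conf (D.conf X) (u ≫ D.π Y)
    (by dsimp; rw [reassoc_of% hu, D.w, comp_zero])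
  exact ⟨u, t, hu, ht⟩

theorem SuspensionChoice.map_unique (hE : E.IsFrobenius) {X Y : A} {f g : X ⟶ Y}
    (h : E.stableRel f g) {u v : D.I X ⟶ D.I Y} {a b : D.T X ⟶ D.T Y}
    (hu : D.ι X ≫ u = f ≫ D.ι Y) (ha : D.π X ≫ a = u ≫ D.π Y)
    (hv : D.ι X ≫ v = g ≫ D.ι Y) (hb : D.π X ≫ b = v ≫ D.π Y) : E.stableRel a b := by
  obtain ⟨P, hP, s, t, w⟩ := h
  obtain ⟨s', hs'⟩ := exists_extension hE ⟨_, _, _, D.conf X⟩ hP s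
  obtain ⟨r, hr⟩ := exists_desc_of_conf (D.conf X) (u - v - s' ≫ t ≫ D.ι Y) (by
    dsimp
    rw [Preadditive.comp_sub, Preadditive.comp_sub, hu, hv, reassoc_of% hs', reassoc_of% w,
      Preadditive.sub_comp, sub_self])
  have : Epi (D.π X) := epi_of_conf (D.conf X)
  dsimp at r hr
  refine ⟨D.I Y, D.mem_ω Y, r, D.π Y, ?_⟩
  rw [← cancel_epi (D.π X), reassoc_of% hr]
  simp [ha, hb, D.w]

/-- The suspension functor as a functor `A ⥤ A/ω`: a morphism `f : X ⟶ Y` is sent to the class of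
any `t : T X ⟶ T Y` for which some `u : I X ⟶ I Y` gives a morphism `(f, u, t)` of conflations. -/
def SuspensionChoice.preShift (hE : E.IsFrobenius) : A ⥤ E.StableCategory where
  obj X := E.toStable.obj (D.T X)
  map f := E.toStable.map (D.exists_map hE f).choose_spec.choose
  map_id X := by
    obtain ⟨h1, h2⟩ := (D.exists_map hE (𝟙 X)).choose_spec.choose_spec
    rw [← E.toStable.map_id]
    exact CategoryTheory.Quotient.sound _ (D.map_unique hE (Congruence.equivalence.refl _) h1 h2
      (v := 𝟙 _) (by simp) (by simp))
  map_comp {X Y Z} f g := by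
    obtain ⟨h1, h2⟩ := (D.exists_map hE f).choose_spec.choose_spec
    obtain ⟨h3, h4⟩ := (D.exists_map hE g).choose_spec.choose_spec
    obtain ⟨h5, h6⟩ := (D.exists_map hE (f ≫ g)).choose_spec.choose_spec
    rw [← E.toStable.map_comp]
    exact CategoryTheory.Quotient.sound _ (D.map_unique hE (Congruence.equivalence.refl _) h5 h6
      (v := (D.exists_map hE f).choose ≫ (D.exists_map hE g).choose)
      (by rw [reassoc_of% h1, h3, Category.assoc])
      (by rw [reassoc_of% h2, h4, Category.assoc]))

/-- The shift functor `[1] : A/ω ⥤ A/ω` of the triangulated category `A/ω`. -/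
def SuspensionChoice.shift (hE : E.IsFrobenius) : E.StableCategory ⥤ E.StableCategory :=
  CategoryTheory.Quotient.lift _ (D.preShift hE) fun X Y f g h => by
    obtain ⟨h1, h2⟩ := (D.exists_map hE f).choose_spec.choose_spec
    obtain ⟨h3, h4⟩ := (D.exists_map hE g).choose_spec.choose_spec
    exact CategoryTheory.Quotient.sound _ (D.map_unique hE h h1 h2 h3 h4)

/-- Any morphism of the chosen conflations over `f` computes `f[1]`. -/
theorem SuspensionChoice.shift_map (hE : E.IsFrobenius) {X Y : A} (f : X ⟶ Y)
    (u : D.I X ⟶ D.I Y) (t : D.T X ⟶ D.T Y) (hu : D.ι X ≫ u = f ≫ D.ι Y)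
    (ht : D.π X ≫ t = u ≫ D.π Y) :
    (D.shift hE).map (E.toStable.map f) = E.toStable.map t := by
  obtain ⟨h1, h2⟩ := (D.exists_map hE f).choose_spec.choose_spec
  exact CategoryTheory.Quotient.sound _ (D.map_unique hE (Congruence.equivalence.refl _) h1 h2 hu ht)

end Biproducts

end ExactStructure

end Exact

/-! ### Orthogonality in a category with a shift functor -/

section Shift

variable {T : Type u'} [Category.{v'} T] [Preadditive T] (shift : T ⥤ T)

/-- `f ⊥ g` for `f : X ⟶ A` and `g : B ⟶ Y`: the composite
`X ⟶ A ⟶ B[1] ⟶ Y[1]` of `f`, `φ` and `g[1]` vanishes for all `φ : A ⟶ B[1]`. -/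
def ShiftOrthogonal {X A B Y : T} (f : X ⟶ A) (g : B ⟶ Y) : Prop :=
  ∀ φ : A ⟶ shift.obj B, f ≫ φ ≫ shift.map g = 0

/-- `M^⊥`: the morphisms `g` with `m ⊥ g` for all `m ∈ M`. -/
def shiftRightPerp (M : MorphismProperty T) : MorphismProperty T :=
  fun _ _ g => ∀ ⦃X A : T⦄ (m : X ⟶ A), M m → ShiftOrthogonal shift m g

/-- `^⊥M`: the morphisms `f` with `f ⊥ m` for all `m ∈ M`. -/
def shiftLeftPerp (M : MorphismProperty T) : MorphismProperty T :=
  fun _ _ f => ∀ ⦃B Y : T⦄ (m : B ⟶ Y), M m → ShiftOrthogonal shift f m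

end Shift

end IdealApprox

end

/-! ### Splitting of conflations. -/

namespace IdealApprox

namespace ExactStructure

variable {A : Type u} [Category.{v} A] [Preadditive A] {E : ExactStructure A}

/-! The reason is the identification of `Ext(X, Y)` with stable morphisms `X ⟶ Y[1]`, of which only
the vanishing criteria are needed. Since `I Y` is injective, every extension of `X` by `Y` maps to
`Y ↣ I Y ↠ T Y` by a morphism that is the identity on `Y`; the map `φ : X ⟶ T Y` on the right
classifies it. Conversely, pulling back the chosen conflation along `φ` gives an extension
classified by `φ`. An extension splits iff its classifying map lifts through `I Y ↠ T Y`
(`exists_section_iff_exists_lift`), and such a lift exists iff the map is stably zero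
(`toStable_map_eq_zero_iff`). If `φ` classifies `ξ` and `t` represents `b[1]`, then `a ≫ φ ≫ t`
classifies the image of `ξ` under `Ext(a, b)` (`map_mk_eq_zero_iff`). Hence `Ext(a, b) = 0` iff the
residue classes of `a` and `b` are orthogonal. The latter condition sees residue classes only, so
membership in a perpendicular class can be tested on any representative, and both equalities follow.
-/

/-- A retraction of the inflation of an extension yields a section of its deflation. -/
theorem Extension.exists_section_of_retraction {X Y : A} (ξ : E.Extension X Y) {r : ξ.M ⟶ Y}
    (hr : ξ.f ≫ r = 𝟙 Y) : ∃ s : X ⟶ ξ.M, s ≫ ξ.g = 𝟙 X := by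
  have : Epi ξ.g := epi_of_conf ξ.conf
  -- The idempotent complementary to `r ≫ ξ.f` kills `ξ.f`, so it factors through the cokernel
  -- `ξ.g`; the factor is the section.
  obtain ⟨s, hs⟩ := exists_desc_of_conf ξ.conf (𝟙 ξ.M - r ≫ ξ.f) (by simp [reassoc_of% hr])
  dsimp at s hs
  refine ⟨s, ?_⟩
  rw [← cancel_epi ξ.g, reassoc_of% hs]
  simp [ξ.w]

/-- If `η` maps to `ζ` by a morphism of conflations `(𝟙, c, τ)`, then `η` splits if and only if
`τ` lifts through the deflation of `ζ`. -/
theorem Extension.exists_section_iff_exists_lift {X X' Y : A} {η : E.Extension X Y}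
    {ζ : E.Extension X' Y} {c : η.M ⟶ ζ.M} {τ : X ⟶ X'} (hf : η.f ≫ c = ζ.f)
    (hg : c ≫ ζ.g = η.g ≫ τ) :
    (∃ s : X ⟶ η.M, s ≫ η.g = 𝟙 X) ↔ ∃ l : X ⟶ ζ.M, l ≫ ζ.g = τ := by
  constructor
  · rintro ⟨s, hs⟩
    exact ⟨s ≫ c, by rw [Category.assoc, hg, reassoc_of% hs]⟩
  · rintro ⟨l, hl⟩
    have : Mono ζ.f := mono_of_conf ζ.conf
    -- Both `c` and `η.g ≫ l` lie over `η.g ≫ τ`, so their difference lands in the kernel `Y`. On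
    -- `Y` the second term vanishes and `c` restricts to `ζ.f`, which makes `r` a retraction.
    obtain ⟨r, hr⟩ := exists_lift_of_conf ζ.conf (c - η.g ≫ l) (by simp [hg, hl])
    dsimp at r hr
    refine η.exists_section_of_retraction (r := r) ?_
    rw [← cancel_mono ζ.f, Category.assoc, hr]
    simp [hf, reassoc_of% η.w]

/-! ### Classifying maps of extensions. -/

namespace SuspensionChoice

variable (D : E.SuspensionChoice)

/-- The chosen conflation `Y ↣ I Y ↠ T Y`, as an extension. -/
def extension (Y : A) : E.Extension (D.T Y) Y :=
  ⟨D.I Y, D.ι Y, D.π Y, D.w Y, D.conf Y⟩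

/-- Every extension of `X` by `Y` maps to the chosen conflation starting at `Y`. -/
theorem exists_classifying_map (hE : E.IsFrobenius) {X Y : A} (ξ : E.Extension X Y) :
    ∃ (c : ξ.M ⟶ D.I Y) (φ : X ⟶ D.T Y), ξ.f ≫ c = D.ι Y ∧ c ≫ D.π Y = ξ.g ≫ φ := by
  obtain ⟨c, hc⟩ := exists_extension hE ⟨_, _, _, ξ.conf⟩ (D.mem_ω Y) (D.ι Y)
  obtain ⟨φ, hφ⟩ := exists_desc_of_conf ξ.conf (c ≫ D.π Y)
    (by dsimp; rw [reassoc_of% hc, D.w])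
  exact ⟨c, φ, hc, hφ.symm⟩

end SuspensionChoice

/-- The class of an extension in `Ext(X, Y)`. -/
def Ext.mk {X Y : A} (ξ : E.Extension X Y) : E.Ext X Y :=
  _root_.Quotient.mk _ ξ

/-! ### Vanishing in `Ext` and in the stable category. -/

section Biproducts

variable [HasZeroObject A] [HasBinaryBiproducts A]

/-- The class of an extension vanishes if and only if its deflation has a section. -/
theorem Ext.mk_eq_zero_iff {X Y : A} (ξ : E.Extension X Y) :
    Ext.mk ξ = 0 ↔ ∃ s : X ⟶ ξ.M, s ≫ ξ.g = 𝟙 X := by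
  constructor
  · intro h
    obtain ⟨e, -, h2⟩ : ∃ e : ξ.M ≅ Y ⊞ X,
        ξ.f ≫ e.hom = biprod.inl ∧ e.hom ≫ biprod.snd = ξ.g := _root_.Quotient.exact h
    exact ⟨biprod.inr ≫ e.inv, by simp [← h2]⟩
  · rintro ⟨s, hs⟩
    have : Mono ξ.f := mono_of_conf ξ.conf
    -- The retraction with kernel `s`: together `r` and `ξ.g` are the coordinates of `ξ.M` as `Y ⊞
    -- X`.
    obtain ⟨r, hr⟩ := exists_lift_of_conf ξ.conf (𝟙 ξ.M - ξ.g ≫ s) (by simp [hs])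
    dsimp at r hr
    have hfr : ξ.f ≫ r = 𝟙 Y := by
      rw [← cancel_mono ξ.f, Category.assoc, hr]
      simp [reassoc_of% ξ.w]
    have hsr : s ≫ r = 0 := by
      rw [← cancel_mono ξ.f, Category.assoc, hr]
      simp [reassoc_of% hs]
    let e : ξ.M ≅ Y ⊞ X :=
      { hom := biprod.lift r ξ.g
        inv := biprod.desc ξ.f s
        hom_inv_id := by simp [hr]
        inv_hom_id := by ext <;> simp [hfr, hsr, hs, ξ.w] }
    have h1 : ξ.f ≫ e.hom = biprod.inl := by ext <;> simp [e, hfr, ξ.w]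
    have h2 : e.hom ≫ biprod.snd = ξ.g := by simp [e]
    exact _root_.Quotient.sound (b := Extension.split E X Y) ⟨e, h1, h2⟩

namespace SuspensionChoice

variable (D : E.SuspensionChoice)

/-- If `φ` classifies `ξ` and `t` represents `b[1]`, then `Ext(a, b)` kills the class of `ξ` if and
only if `a ≫ φ ≫ t` lifts through `I B₁ ↠ T B₁`. -/
theorem map_mk_eq_zero_iff {A₀ A₁ B₀ B₁ : A} (a : A₀ ⟶ A₁) (b : B₀ ⟶ B₁)
    (ξ : E.Extension A₁ B₀) {c : ξ.M ⟶ D.I B₀} {φ : A₁ ⟶ D.T B₀}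
    (hc : ξ.f ≫ c = D.ι B₀) (hφ : c ≫ D.π B₀ = ξ.g ≫ φ)
    {u : D.I B₀ ⟶ D.I B₁} {t : D.T B₀ ⟶ D.T B₁} (hu : D.ι B₀ ≫ u = b ≫ D.ι B₁)
    (ht : D.π B₀ ≫ t = u ≫ D.π B₁) :
    Ext.map a b (Ext.mk ξ) = 0 ↔
      ∃ l : A₀ ⟶ D.I B₁, l ≫ D.π B₁ = a ≫ φ ≫ t := by
  obtain ⟨p, hp, hp'⟩ := ξ.pullback_spec a
  obtain ⟨q, hq, hq'⟩ := (ξ.pullback a).pushforward_spec b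
  -- The composite `p ≫ c ≫ u` agrees with `b ≫ D.ι B₁` on `B₀`, so the two induce a map from the
  -- pushout to `I B₁` which restricts to `D.ι B₁` on `B₁`.
  have w : (ξ.pullback a).f ≫ p ≫ c ≫ u = b ≫ D.ι B₁ := by
    rw [reassoc_of% hp', reassoc_of% hc, hu]
  -- The right-hand square of the resulting morphism of conflations: `a ≫ φ ≫ t` classifies the
  -- pulled back and pushed out extension.
  have w' : hq.desc (p ≫ c ≫ u) (D.ι B₁) w ≫ D.π B₁ =
      ((ξ.pullback a).pushforward b).g ≫ a ≫ φ ≫ t := by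
    refine hq.hom_ext ?_ ?_
    · rw [hq.inl_desc_assoc, reassoc_of% hq', ← hp.w_assoc, ← reassoc_of% hφ, ht]
      simp
    · rw [hq.inr_desc_assoc, reassoc_of% Extension.w, zero_comp, D.w]
  exact (Ext.mk_eq_zero_iff ((ξ.pullback a).pushforward b)).trans
    (Extension.exists_section_iff_exists_lift (ζ := D.extension B₁) (hq.inr_desc _ _ w) w')

/-- A morphism to `T Y` vanishes in the stable category if and only if it lifts through
`I Y ↠ T Y`. -/
theorem toStable_map_eq_zero_iff {X Y : A} (f : X ⟶ D.T Y) :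
    E.toStable.map f = 0 ↔ ∃ l : X ⟶ D.I Y, l ≫ D.π Y = f := by
  rw [show (0 : E.toStable.obj X ⟶ E.toStable.obj (D.T Y)) = E.toStable.map 0 from rfl,
    CategoryTheory.Quotient.functor_map_eq_iff]
  constructor
  · rintro ⟨P, hP, s, t, w⟩
    -- It suffices to lift `t : P ⟶ T Y`. The pullback of `D.π Y` along `t` is a deflation onto the
    -- projective `P`, hence splits.
    obtain ⟨_, k, q, h, hq⟩ := E.pullback_deflation (D.π Y) t ⟨_, _, _, D.conf Y⟩
    have := hP q hq
    exact ⟨s ≫ section_ q ≫ k, by simp [h.w, w]⟩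
  · rintro ⟨l, hl⟩
    exact ⟨D.I Y, D.mem_ω Y, l, D.π Y, by simp [hl]⟩

/-- `Ext`-orthogonality in a Frobenius category is orthogonality in the stable category. -/
theorem shiftOrthogonal_iff_extOrthogonal (hE : E.IsFrobenius) {A₀ A₁ B₀ B₁ : A}
    (a : A₀ ⟶ A₁) (b : B₀ ⟶ B₁) :
    ShiftOrthogonal (D.shift hE) (E.toStable.map a) (E.toStable.map b) ↔
      E.ExtOrthogonal a b := by
  obtain ⟨u, t, hu, ht⟩ := D.exists_map hE b
  have key (φ : A₁ ⟶ D.T B₀) :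
      E.toStable.map a ≫ E.toStable.map φ ≫ (D.shift hE).map (E.toStable.map b) = 0 ↔
        ∃ l : A₀ ⟶ D.I B₁, l ≫ D.π B₁ = a ≫ φ ≫ t := by
    rw [D.shift_map hE b u t hu ht, ← D.toStable_map_eq_zero_iff, E.toStable.map_comp,
      E.toStable.map_comp]
    -- The sides differ only in writing the target as the shift of `B₁` or as the image of `D.T B₁`.
    rfl
  constructor
  · intro h x
    induction x using _root_.Quotient.inductionOn with
    | h ξ =>
      obtain ⟨c, φ, hc, hφ⟩ := D.exists_classifying_map hE ξ
      exact (D.map_mk_eq_zero_iff a b ξ hc hφ hu ht).2 ((key φ).1 (h _))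
  · intro h φ
    obtain ⟨φ, rfl⟩ := E.toStable.map_surjective (X := A₁) (Y := D.T B₀) φ
    -- Every `φ` classifies some extension, namely this pullback, so testing on extensions tests all
    -- `φ`.
    obtain ⟨c, hc, hc'⟩ := (D.extension B₀).pullback_spec φ
    exact (key φ).2 ((D.map_mk_eq_zero_iff a b _ hc' hc.w hu ht).1 (h _))

end SuspensionChoice

end Biproducts

end ExactStructure

end IdealApprox

/-! ### The two perpendicular classes. -/

theorem proposition3p4 {A : Type u} [Category.{v} A] [Preadditive A]
    [HasZeroObject A] [HasBinaryBiproducts A]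
    (E : IdealApprox.ExactStructure A) (hE : E.IsFrobenius) (D : E.SuspensionChoice)
    (S : MorphismProperty A) (hS : ∀ X : A, E.Projective X → S (𝟙 X)) :
    IdealApprox.shiftRightPerp (D.shift hE) (E.modω S) = E.modω (E.rightPerp S) ∧
    IdealApprox.shiftLeftPerp (D.shift hE) (E.modω S) = E.modω (E.leftPerp S) := by
  constructor
  · ext X Y g
    constructor
    · intro h
      -- An arbitrary representative will do, since the stable condition does not depend on it.
      obtain ⟨b, rfl⟩ := E.toStable.map_surjective (X := X.as) (Y := Y.as) g
      exact ⟨fun _ _ m hm => (D.shiftOrthogonal_iff_extOrthogonal hE m b).1 (h _ ⟨hm⟩)⟩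
    · rintro ⟨hb⟩ _ _ _ ⟨hm⟩
      exact (D.shiftOrthogonal_iff_extOrthogonal hE _ _).2 (hb _ hm)
  · ext X Y f
    constructor
    · intro h
      obtain ⟨a, rfl⟩ := E.toStable.map_surjective (X := X.as) (Y := Y.as) f
      exact ⟨fun _ _ m hm => (D.shiftOrthogonal_iff_extOrthogonal hE a m).1 (h _ ⟨hm⟩)⟩
    · rintro ⟨ha⟩ _ _ _ ⟨hm⟩
      exact (D.shiftOrthogonal_iff_extOrthogonal hE _ _).2 (ha _ hm)
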